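/- Let $S$ be a positive cone of an abelian group $G$ (written additively), i.e. a subsemigroup of $G$ containing $0$ such that $S\cap(-S)=\{0\}$ and every $g\in G$ is of the form $g=s-t$ with $s,t\in S$. Let $V_s\in\mathcal B(\ell^2(S))$, $s\in S$, be the isometries with $V_s e_t=e_{s+t}$ for $t\in S$, and let $\mathcal A(S)\subseteq\mathcal B(\ell^2(S))$ be the norm closure of the algebra generated by $\{V_s: s\in S\}$. Let $H$ be a complex Hilbert space and let $\rho:\mathcal A(S)\to\mathcal B(H)$ be a representation, i.e. a bounded unital algebra homomorphism. Then the following are equivalent: (i) $\rho$ is completely contractive, i.e. $\|[\rho(a_{ij})]\|_{\mathcal B(H^n)}\le\|[a_{ij}]\|_{\mathcal B(\ell^2(S)^n)}$ for all $n$ and all $n\times n$ matrices $[a_{ij}]$ over $\mathcal A(S)$; (ii) there are a Hilbert space $K\supseteq H$ and a unitary representation $U:G\to\mathcal B(K)$ (a group homomorphism from $G$ into the unitary group of $\mathcal B(K)$) such that $\rho(V_s)=P_H U_s|_H$ for all $s\in S$, where $P_H$ is the orthogonal projection of $K$ onto $H$. -/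

import Mathlib

universe u v

/-- A positive cone of an abelian group `G`: a unital subsemigroup `S` with `S ∩ (-S) = {0}` such
that every element of `G` is a difference of two elements of `S`. -/
structure IsPositiveCone {G : Type*} [AddCommGroup G] (S : AddSubmonoid G) : Prop where
  eq_zero_of_mem_of_neg_mem : ∀ g : G, g ∈ S → -g ∈ S → g = 0
  exists_eq_sub : ∀ g : G, ∃ s ∈ S, ∃ t ∈ S, g = s - t

noncomputable section

/-- The Hilbert space `ℓ²(S)`. -/
abbrev EllTwo (ι : Type*) : Type _ := lp (fun _ : ι => ℂ) 2

/-- The standard basis vector `e_t` of `ℓ²(S)`. -/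
def stdVec {ι : Type*} (t : ι) : EllTwo ι := by
  classical exact lp.single 2 t (1 : ℂ)

theorem orthonormal_stdVec (ι : Type*) : Orthonormal ℂ (stdVec : ι → EllTwo ι) := by
  classical
  rw [orthonormal_iff_ite]
  intro i j
  simp only [stdVec, lp.inner_single_left, lp.single_apply, Pi.single_apply]
  split_ifs <;> simp

section Fock

variable {G : Type*} [AddCommGroup G] (S : AddSubmonoid G)

theorem orthonormal_stdVec_add (s : S) :
    Orthonormal ℂ (fun t : S => (stdVec (s + t) : EllTwo S)) :=
  (orthonormal_stdVec S).comp _ (add_right_injective s)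

/-- The Fock representation `V_s` on `ℓ²(S)`: the isometry with `V_s e_t = e_{s + t}`. -/
def fock (s : S) : EllTwo S →L[ℂ] EllTwo S :=
  (orthonormal_stdVec_add S s).orthogonalFamily.linearIsometry.toContinuousLinearMap

theorem fock_stdVec (s t : S) : fock S s (stdVec t) = stdVec (s + t) := by
  classical
  simp [fock, stdVec]

/-- The nonselfadjoint operator algebra `𝒜(S)`: the operator norm closure of the algebra generated
by the operators `V_s`, `s ∈ S`. -/
def fockAlgebra : Subalgebra ℂ (EllTwo S →L[ℂ] EllTwo S) :=
  (Algebra.adjoin ℂ (Set.range (fock S))).topologicalClosure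

/-- `V_s` as an element of `𝒜(S)`. -/
def fockGen (s : S) : fockAlgebra S :=
  ⟨fock S s, Subalgebra.le_topologicalClosure _ (Algebra.subset_adjoin ⟨s, rfl⟩)⟩

end Fock

section CompletelyContractive

/-- The operator on the Hilbert space `H^n = H ⊕ ⋯ ⊕ H` given by an `n × n` matrix of operators
on `H`. -/
def matrixOperator {H : Type*} [NormedAddCommGroup H] [InnerProductSpace ℂ H] {n : ℕ}
    (M : Matrix (Fin n) (Fin n) (H →L[ℂ] H)) :
    PiLp 2 (fun _ : Fin n => H) →L[ℂ] PiLp 2 (fun _ : Fin n => H) :=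
  (PiLp.continuousLinearEquiv 2 ℂ (fun _ : Fin n => H)).symm.toContinuousLinearMap ∘L
    ContinuousLinearMap.pi fun i => ∑ j, M i j ∘L PiLp.proj 2 (fun _ : Fin n => H) j

theorem matrixOperator_apply {H : Type*} [NormedAddCommGroup H] [InnerProductSpace ℂ H] {n : ℕ}
    (M : Matrix (Fin n) (Fin n) (H →L[ℂ] H)) (x : PiLp 2 (fun _ : Fin n => H)) (i : Fin n) :
    matrixOperator M x i = ∑ j, M i j (x j) := by
  simp [matrixOperator]

/-- A linear map `φ` from an operator algebra `A ⊆ B(E)` into `B(H)` is completely contractive if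
all its amplifications `M_n(A) → M_n(B(H)) = B(H^n)` are contractive, where `M_n(A)` carries the
norm of `B(E^n)`. -/
def IsCompletelyContractive {E H : Type*} [NormedAddCommGroup E] [InnerProductSpace ℂ E]
    [NormedAddCommGroup H] [InnerProductSpace ℂ H] {A : Subalgebra ℂ (E →L[ℂ] E)}
    (φ : A →ₗ[ℂ] (H →L[ℂ] H)) : Prop :=
  ∀ (n : ℕ) (a : Matrix (Fin n) (Fin n) A),
    ‖matrixOperator fun i j => φ (a i j)‖ ≤ ‖matrixOperator fun i j => (a i j : E →L[ℂ] E)‖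

end CompletelyContractive

end

/-! A unitary dilation gives complete contractivity by transference. Spread a vector of `K` along
its orbit over a finite set `F` in `S`; this gives vectors of `ℓ²(S)` on which the `V_s` reproduce
the action of `U` at the points of a second set `F'`. Commutative monoids have polynomial growth, so
`|F| / |F'|` can be bounded by any constant above 1 (`exists_folner`), and matrices of polynomials
in `U` obey the norm bounds of the same matrices in `V` (`sum_norm_sq_le_of_fock`). Compression to
`H` and density then give the claim.

Conversely, a unital complete contraction preserves accretive matrices. Hence `(s, h) ⊗ (0, k) ↦ Re
⟪k, ρ(V_s) h⟫` is nonnegative wherever all the forms `Re ⟪induced W y, induced W x⟫` are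
(`reForm_fockEval_nonneg`), and M. Riesz's theorem extends it positively to all tensors. The
extension inherits every linear identity common to these forms: symmetry, compatibility with `i`,
translation invariance. Its Hilbert space thus carries a unitary representation of `G` dilating `ρ`
(`exists_dilation`). -/

/-! ### Følner sets from polynomial growth. -/

section Folner

variable {M : Type*} [AddCommMonoid M]

open Classical in
/-- The sums `∑ a t • t` over `t ∈ T` with coefficients at most `N`. -/
noncomputable def cubeSums (T : Finset M) (N : ℕ) : Finset M :=
  (Fintype.piFinset fun _ : T => Finset.range (N + 1)).image fun a => ∑ t : T, a t • (t : M)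

theorem card_cubeSums_le (T : Finset M) (N : ℕ) : (cubeSums T N).card ≤ (N + 1) ^ T.card := by
  classical
  refine Finset.card_image_le.trans ?_
  simp

theorem cubeSums_nonempty (T : Finset M) (N : ℕ) : (cubeSums T N).Nonempty := by
  classical
  refine Finset.Nonempty.image ⟨0, ?_⟩ _
  simp

/-- Removing `s` from the sum over `T` leaves coefficients 0 and 1, which raise those of `x` by at
most one. -/
theorem exists_cubeSums_add (T : Finset M) (N : ℕ) {s : M} (hs : s ∈ T) {x : M}
    (hx : x ∈ cubeSums T N) : ∃ f ∈ cubeSums T (N + 1), s + f = ∑ t ∈ T, t + x := by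
  classical
  obtain ⟨a, ha, rfl⟩ := Finset.mem_image.1 hx
  rw [Fintype.mem_piFinset] at ha
  refine ⟨_, Finset.mem_image.2 ⟨fun t => a t + if (t : M) = s then 0 else 1, ?_, rfl⟩, ?_⟩
  · rw [Fintype.mem_piFinset]
    intro t
    have := Finset.mem_range.1 (ha t)
    rw [Finset.mem_range]
    split_ifs <;> omega
  · simp only [add_smul, Finset.sum_add_distrib]
    rw [add_left_comm, add_comm]
    congr 1
    rw [Finset.sum_coe_sort T fun t => (if t = s then 0 else 1) • t, ← Finset.add_sum_erase _ _ hs,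
      ← Finset.add_sum_erase T _ hs]
    simp only [if_true, zero_smul, zero_add]
    congr 1
    refine Finset.sum_congr rfl fun t ht => ?_
    rw [if_neg (Finset.ne_of_mem_erase ht), one_smul]

/-- Otherwise the cardinalities would grow at least like `c ^ N`, against the polynomial bound `(N +
1) ^ T.card`. -/
theorem exists_card_cubeSums_succ_le (T : Finset M) {c : ℝ} (hc : 1 < c) :
    ∃ N, ((cubeSums T (N + 1)).card : ℝ) ≤ c * (cubeSums T N).card := by
  by_contra! h
  have growth : ∀ N : ℕ, c ^ N ≤ (cubeSums T N).card := by
    intro N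
    induction N with
    | zero =>
      rw [pow_zero]
      exact_mod_cast (cubeSums_nonempty T 0).card_pos
    | succ N ih =>
      rw [pow_succ']
      exact (mul_le_mul_of_nonneg_left ih (by linarith)).trans (h N).le
  have bound : ∀ N : ℕ, 1 ≤ ((N + 1 : ℕ) : ℝ) ^ T.card / c ^ (N + 1) * c := by
    intro N
    have hcN : 0 < c ^ N := pow_pos (by linarith) N
    have := (growth N).trans (by exact_mod_cast card_cubeSums_le T N :
      ((cubeSums T N).card : ℝ) ≤ ((N + 1 : ℕ) : ℝ) ^ T.card)
    rw [pow_succ, div_mul_eq_mul_div, mul_div_mul_right _ _ (by linarith), le_div_iff₀ hcN]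
    simpa using this
  have lim := (((Filter.tendsto_add_atTop_iff_nat 1).2
    (tendsto_pow_const_div_const_pow_of_one_lt T.card hc)).mul_const c)
  rw [zero_mul] at lim
  exact absurd (ge_of_tendsto' lim bound) (by norm_num)

/-- A Følner condition for finite subsets of a commutative cancellative monoid. -/
theorem exists_folner [IsCancelAdd M] (T : Finset M) {c : ℝ} (hc : 1 < c) :
    ∃ F F' : Finset M, F'.Nonempty ∧ (F.card : ℝ) ≤ c * F'.card ∧
      ∀ s ∈ T, ∀ g ∈ F', ∃ f ∈ F, s + f = g := by
  classical
  obtain ⟨N, hN⟩ := exists_card_cubeSums_succ_le T hc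
  -- Translating by the sum over `T` leaves room to subtract any `s ∈ T`.
  refine ⟨cubeSums T (N + 1), (cubeSums T N).image (∑ t ∈ T, t + ·),
    (cubeSums_nonempty T N).image _, ?_, ?_⟩
  · rwa [Finset.card_image_of_injective _ (add_right_injective _)]
  · intro s hs g hg
    obtain ⟨x, hx, rfl⟩ := Finset.mem_image.1 hg
    exact exists_cubeSums_add T N hs hx

end Folner

/-! ### Transference from `V` to unitary representations. -/

section Transfer

theorem norm_sq_sum_smul_orthonormal {ι E : Type*} [NormedAddCommGroup E] [InnerProductSpace ℂ E]
    {v : ι → E} (hv : Orthonormal ℂ v) (F : Finset ι) (a : ι → ℂ) :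
    ‖∑ f ∈ F, a f • v f‖ ^ 2 = ∑ f ∈ F, ‖a f‖ ^ 2 := by
  have h := hv.inner_sum a a F
  rw [inner_self_eq_norm_sq_to_K] at h
  have h2 : ∀ f, starRingEnd ℂ (a f) * a f = ((‖a f‖ ^ 2 : ℝ) : ℂ) := fun f => by
    rw [RCLike.conj_mul]; simp
  simp only [h2, ← Complex.ofReal_sum] at h
  exact Complex.ofReal_injective (by simpa using h)

variable {G : Type*} [AddCommGroup G] {S : AddSubmonoid G}
  {K : Type*} [NormedAddCommGroup K] [InnerProductSpace ℂ K]

/-- By cancellation only the `f` with `s + f = g` contributes, and `-f = -g + s`. -/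
theorem inner_stdVec_fock_sum {u : G → K →L[ℂ] K} (hu : ∀ a b x, u (a + b) x = u a (u b x))
    (e y : K) (F : Finset S) {s g : S} (h : ∃ f ∈ F, s + f = g) :
    inner ℂ (stdVec g) (fock S s (∑ f ∈ F, inner ℂ e (u (-(f : G)) y) • stdVec f)) =
      inner ℂ e (u (-(g : G)) (u (s : G) y)) := by
  classical
  obtain ⟨f₀, hf₀, rfl⟩ := h
  simp only [map_sum, map_smul, fock_stdVec, inner_sum, inner_smul_right]
  rw [Finset.sum_eq_single f₀]
  · rw [inner_self_eq_norm_sq_to_K, (orthonormal_stdVec S).1, ← hu]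
    simp
  · intro f _ hf
    rw [(orthonormal_stdVec S).2 (fun h => hf (add_left_cancel h).symm), mul_zero]
  · exact fun h => absurd hf₀ h

variable {n : ℕ}

theorem card_mul_sum_norm_sq_le {u : G → K →L[ℂ] K} (hu : ∀ a b x, u (a + b) x = u a (u b x))
    (hu' : ∀ a x, ‖u a x‖ = ‖x‖) (T : Finset S) (c : Fin n → Fin n → S → ℂ) {M : ℝ} (hM : 0 ≤ M)
    (h : ∀ w : Fin n → EllTwo S, ∑ i, ‖∑ j, ∑ s ∈ T, c i j s • fock S s (w j)‖ ^ 2 ≤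
      M * ∑ j, ‖w j‖ ^ 2) (y : Fin n → K) (F F' : Finset S)
    (hF : ∀ s ∈ T, ∀ g ∈ F', ∃ f ∈ F, s + f = g) :
    F'.card * ∑ i, ‖∑ j, ∑ s ∈ T, c i j s • u (s : G) (y j)‖ ^ 2 ≤
      M * (F.card * ∑ j, ‖y j‖ ^ 2) := by
  set B : Fin n → K := fun i => ∑ j, ∑ s ∈ T, c i j s • u (s : G) (y j) with hB
  -- A finite-dimensional space containing all `u (-g) (B i)`: Parseval is exact for these vectors,
  -- while Bessel suffices for the `y j`.
  let P : Submodule ℂ K := Submodule.span ℂ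
    (Set.range fun p : Fin n × F' => u (-((p.2 : S) : G)) (B p.1))
  have : FiniteDimensional ℂ P := FiniteDimensional.span_of_finite ℂ (Set.finite_range _)
  let b := stdOrthonormalBasis ℂ P
  let e := fun k => (b k : K)
  have he : Orthonormal ℂ e := b.orthonormal.comp_linearIsometry P.subtypeₗᵢ
  have parseval : ∀ i, ∀ g ∈ F', ∑ k, ‖inner ℂ (e k) (u (-(g : G)) (B i))‖ ^ 2 = ‖B i‖ ^ 2 := by
    intro i g hg
    have hmem : u (-(g : G)) (B i) ∈ P := Submodule.subset_span ⟨(i, ⟨g, hg⟩), rfl⟩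
    rw [← hu' (-(g : G)) (B i)]
    exact b.sum_sq_norm_inner_right ⟨_, hmem⟩
  -- The orbit of `y j` over `F`, read in the coordinate `e k`.
  let w := fun k j => ∑ f ∈ F, inner ℂ (e k) (u (-(f : G)) (y j)) • stdVec f
  have upper : ∑ k, ∑ j, ‖w k j‖ ^ 2 ≤ F.card * ∑ j, ‖y j‖ ^ 2 := by
    simp only [w, norm_sq_sum_smul_orthonormal (orthonormal_stdVec S)]
    rw [Finset.sum_comm, Finset.mul_sum]
    refine Finset.sum_le_sum fun j _ => ?_
    rw [Finset.sum_comm, ← nsmul_eq_mul, ← Finset.sum_const]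
    refine Finset.sum_le_sum fun f _ => ?_
    rw [← hu' (-(f : G)) (y j)]
    exact he.sum_inner_products_le _
  have lower : ∀ k i, ∑ g ∈ F', ‖inner ℂ (e k) (u (-(g : G)) (B i))‖ ^ 2 ≤
      ‖∑ j, ∑ s ∈ T, c i j s • fock S s (w k j)‖ ^ 2 := by
    intro k i
    refine le_of_eq_of_le ?_ ((orthonormal_stdVec S).sum_inner_products_le (s := F') _)
    refine Finset.sum_congr rfl fun g hg => ?_
    congr 2
    simp only [hB, map_sum, map_smul, inner_sum, inner_smul_right]
    refine Finset.sum_congr rfl fun j _ => Finset.sum_congr rfl fun s hs => ?_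
    rw [← inner_stdVec_fock_sum hu (e k) (y j) F (hF s hs g hg)]
  calc F'.card * ∑ i, ‖B i‖ ^ 2 = ∑ k, ∑ i, ∑ g ∈ F', ‖inner ℂ (e k) (u (-(g : G)) (B i))‖ ^ 2 := by
        rw [Finset.sum_comm, Finset.mul_sum]
        refine Finset.sum_congr rfl fun i _ => ?_
        rw [Finset.sum_comm, ← nsmul_eq_mul, ← Finset.sum_const]
        exact Finset.sum_congr rfl fun g hg => (parseval i g hg).symm
    _ ≤ ∑ k, ∑ i, ‖∑ j, ∑ s ∈ T, c i j s • fock S s (w k j)‖ ^ 2 :=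
        Finset.sum_le_sum fun k _ => Finset.sum_le_sum fun i _ => lower k i
    _ ≤ ∑ k, M * ∑ j, ‖w k j‖ ^ 2 := Finset.sum_le_sum fun k _ => h (w k)
    _ ≤ M * (F.card * ∑ j, ‖y j‖ ^ 2) := by
        rw [← Finset.mul_sum]
        exact mul_le_mul_of_nonneg_left upper hM

theorem sum_norm_sq_le_of_fock {u : G → K →L[ℂ] K} (hu : ∀ a b x, u (a + b) x = u a (u b x))
    (hu' : ∀ a x, ‖u a x‖ = ‖x‖) (T : Finset S) (c : Fin n → Fin n → S → ℂ) {M : ℝ} (hM : 0 ≤ M)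
    (h : ∀ w : Fin n → EllTwo S, ∑ i, ‖∑ j, ∑ s ∈ T, c i j s • fock S s (w j)‖ ^ 2 ≤
      M * ∑ j, ‖w j‖ ^ 2) (y : Fin n → K) :
    ∑ i, ‖∑ j, ∑ s ∈ T, c i j s • u (s : G) (y j)‖ ^ 2 ≤ M * ∑ j, ‖y j‖ ^ 2 := by
  have key : ∀ r : ℝ, 1 < r → ∑ i, ‖∑ j, ∑ s ∈ T, c i j s • u (s : G) (y j)‖ ^ 2 ≤
      r * (M * ∑ j, ‖y j‖ ^ 2) := by
    intro r hr
    obtain ⟨F, F', hne, hcard, hF⟩ := exists_folner T hr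
    have hpos : (0 : ℝ) < F'.card := by exact_mod_cast hne.card_pos
    refine le_of_mul_le_mul_left ?_ hpos
    refine (card_mul_sum_norm_sq_le hu hu' T c hM h y F F' hF).trans ?_
    have : 0 ≤ M * ∑ j, ‖y j‖ ^ 2 := by positivity
    calc M * (F.card * ∑ j, ‖y j‖ ^ 2) = F.card * (M * ∑ j, ‖y j‖ ^ 2) := by ring
      _ ≤ (r * F'.card) * (M * ∑ j, ‖y j‖ ^ 2) := mul_le_mul_of_nonneg_right hcard this
      _ = _ := by ring
  have lim : Filter.Tendsto (fun r : ℝ => r * (M * ∑ j, ‖y j‖ ^ 2)) (nhdsWithin 1 (Set.Ioi 1))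
      (nhds (M * ∑ j, ‖y j‖ ^ 2)) := by
    have : Continuous fun r : ℝ => r * (M * ∑ j, ‖y j‖ ^ 2) := by fun_prop
    simpa using (this.tendsto 1).mono_left nhdsWithin_le_nhds
  exact ge_of_tendsto lim (Filter.eventually_of_mem self_mem_nhdsWithin key)

end Transfer

/-! ### Norm and continuity of operator matrices. -/

section Dilated

variable {H : Type*} [NormedAddCommGroup H] [InnerProductSpace ℂ H] {n : ℕ}

theorem norm_sq_matrixOperator_apply (M : Matrix (Fin n) (Fin n) (H →L[ℂ] H))
    (x : PiLp 2 fun _ : Fin n => H) :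
    ‖matrixOperator M x‖ ^ 2 = ∑ i, ‖∑ j, M i j (x j)‖ ^ 2 := by
  rw [PiLp.norm_sq_eq_of_L2]
  simp only [matrixOperator_apply]

theorem sum_norm_sq_le_norm_matrixOperator (M : Matrix (Fin n) (Fin n) (H →L[ℂ] H))
    (w : Fin n → H) :
    ∑ i, ‖∑ j, M i j (w j)‖ ^ 2 ≤ ‖matrixOperator M‖ ^ 2 * ∑ j, ‖w j‖ ^ 2 := by
  have h := norm_sq_matrixOperator_apply M (WithLp.toLp 2 w)
  have h2 := PiLp.norm_sq_eq_of_L2 (fun _ : Fin n => H) (WithLp.toLp 2 w)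
  simp only at h h2
  rw [← h, ← h2, ← mul_pow]
  exact pow_le_pow_left₀ (norm_nonneg _) ((matrixOperator M).le_opNorm _) 2

theorem norm_matrixOperator_le (M : Matrix (Fin n) (Fin n) (H →L[ℂ] H)) {C : ℝ} (hC : 0 ≤ C)
    (h : ∀ w : Fin n → H, ∑ i, ‖∑ j, M i j (w j)‖ ^ 2 ≤ C ^ 2 * ∑ j, ‖w j‖ ^ 2) :
    ‖matrixOperator M‖ ≤ C := by
  refine ContinuousLinearMap.opNorm_le_bound _ hC fun x => ?_
  rw [← sq_le_sq₀ (norm_nonneg _) (by positivity), mul_pow, norm_sq_matrixOperator_apply,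
    PiLp.norm_sq_eq_of_L2]
  exact h x

theorem matrixOperator_eq_sum (M : Matrix (Fin n) (Fin n) (H →L[ℂ] H)) :
    matrixOperator M = ∑ i, ∑ j,
      ((PiLp.continuousLinearEquiv 2 ℂ fun _ : Fin n => H).symm.toContinuousLinearMap ∘L
        ContinuousLinearMap.single ℂ (fun _ : Fin n => H) i) ∘L M i j ∘L
          PiLp.proj 2 (fun _ : Fin n => H) j := by
  ext x k
  rw [matrixOperator_apply]
  simp [Pi.single_apply]

set_option synthInstance.maxHeartbeats 200000 in
theorem continuous_matrixOperator :
    Continuous (matrixOperator : Matrix (Fin n) (Fin n) (H →L[ℂ] H) → _) := by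
  simp only [funext matrixOperator_eq_sum]
  refine continuous_finsetSum _ fun i _ => continuous_finsetSum _ fun j _ => ?_
  exact continuous_const.clm_comp ((continuous_apply_apply i j).clm_comp continuous_const)

end Dilated

/-! ### Density of the span of the `V_s`. -/

section FockAlgebra

theorem ext_stdVec {ι F : Type*} [NormedAddCommGroup F] [NormedSpace ℂ F] {f g : EllTwo ι →L[ℂ] F}
    (h : ∀ t, f (stdVec t) = g (stdVec t)) : f = g := by
  classical
  ext x
  have hx := lp.hasSum_single (p := 2) (by simp) x
  have key : ∀ i, lp.single 2 i (x i) = (x i) • (stdVec i : EllTwo ι) := fun i => by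
    simp only [stdVec, ← lp.single_smul, smul_eq_mul, mul_one]
  simp only [key] at hx
  refine (hx.mapL f).unique ?_
  simpa only [map_smul, h] using hx.mapL g

variable {G : Type*} [AddCommGroup G] (S : AddSubmonoid G)

theorem fock_zero : fock S 0 = 1 := ext_stdVec fun t => by
  rw [fock_stdVec, zero_add, one_apply_eq_self]

theorem fock_add (s t : S) : fock S (s + t) = fock S s * fock S t := ext_stdVec fun r => by
  rw [mul_apply_eq_comp, fock_stdVec, fock_stdVec, fock_stdVec, add_assoc]

theorem fockGen_zero : fockGen S 0 = 1 := Subtype.ext (fock_zero S)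

theorem toSubmodule_adjoin_range_fock :
    (Algebra.adjoin ℂ (Set.range (fock S))).toSubmodule = Submodule.span ℂ (Set.range (fock S)) := by
  refine Algebra.adjoin_eq_span_of_subset (R := ℂ) fun x hx => ?_
  refine Submodule.subset_span ?_
  induction hx using Submonoid.closure_induction with
  | mem x hx => exact hx
  | one => exact ⟨0, fock_zero S⟩
  | mul x y _ _ hx hy =>
    obtain ⟨s, rfl⟩ := hx
    obtain ⟨t, rfl⟩ := hy
    exact ⟨s + t, fock_add S s t⟩

theorem denseRange_linearCombination_fockGen :
    DenseRange (Finsupp.linearCombination ℂ (fockGen S)) := by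
  intro x
  rw [closure_subtype]
  have hx : (x : EllTwo S →L[ℂ] EllTwo S) ∈
      closure (Algebra.adjoin ℂ (Set.range (fock S)) : Set (EllTwo S →L[ℂ] EllTwo S)) := x.2
  refine closure_mono ?_ hx
  intro y hy
  have hy' : y ∈ Submodule.span ℂ (Set.range (fock S)) := by
    rw [← toSubmodule_adjoin_range_fock]
    exact hy
  obtain ⟨c, rfl⟩ := Finsupp.mem_span_range_iff_exists_finsupp.1 hy'
  refine ⟨_, ⟨c, rfl⟩, ?_⟩
  simp [Finsupp.linearCombination_apply, Finsupp.sum, fockGen]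

end FockAlgebra

/-! ### Dilation implies complete contractivity. -/

section Compression

variable {G : Type*} [AddCommGroup G] {S : AddSubmonoid G}
  {H : Type*} [NormedAddCommGroup H] [InnerProductSpace ℂ H] [CompleteSpace H]
  {K : Type*} [NormedAddCommGroup K] [InnerProductSpace ℂ K] [CompleteSpace K] {n : ℕ}

theorem norm_matrixOperator_linearCombination_le (φ : fockAlgebra S →ₗ[ℂ] (H →L[ℂ] H))
    (ι : H →ₗᵢ[ℂ] K) {u : G → K →L[ℂ] K} (hu : ∀ a b x, u (a + b) x = u a (u b x))
    (hu' : ∀ a x, ‖u a x‖ = ‖x‖)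
    (hφ : ∀ s : S, φ (fockGen S s) = ContinuousLinearMap.adjoint ι.toContinuousLinearMap ∘L
      u (s : G) ∘L ι.toContinuousLinearMap) (c : Fin n → Fin n → S →₀ ℂ) :
    ‖matrixOperator fun i j => φ (Finsupp.linearCombination ℂ (fockGen S) (c i j))‖ ≤
      ‖matrixOperator fun i j =>
        (Finsupp.linearCombination ℂ (fockGen S) (c i j) : EllTwo S →L[ℂ] EllTwo S)‖ := by
  classical
  let T : Finset S := Finset.univ.biUnion fun i => Finset.univ.biUnion fun j => (c i j).support
  have hT : ∀ i j, (c i j).support ⊆ T := fun i j s hs =>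
    Finset.mem_biUnion.2 ⟨i, Finset.mem_univ i, Finset.mem_biUnion.2 ⟨j, Finset.mem_univ j, hs⟩⟩
  have hsum : ∀ i j, Finsupp.linearCombination ℂ (fockGen S) (c i j) =
      ∑ s ∈ T, c i j s • fockGen S s := fun i j =>
    Finsupp.sum_of_support_subset _ (hT i j) _ (by simp)
  refine norm_matrixOperator_le _ (norm_nonneg _) fun w => ?_
  have bound := sum_norm_sq_le_norm_matrixOperator fun i j =>
    (Finsupp.linearCombination ℂ (fockGen S) (c i j) : EllTwo S →L[ℂ] EllTwo S)
  have dilated := sum_norm_sq_le_of_fock hu hu' T (fun i j s => c i j s) (sq_nonneg _)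
    (fun w => by simpa [hsum, fockGen, sum_apply] using bound w)
    (fun j => ι (w j))
  simp only [ι.norm_map] at dilated
  refine le_trans (Finset.sum_le_sum fun i _ => ?_) (by simpa [hsum, fockGen] using dilated)
  have : ∑ j, φ (Finsupp.linearCombination ℂ (fockGen S) (c i j)) (w j) =
      ContinuousLinearMap.adjoint ι.toContinuousLinearMap
        (∑ j, ∑ s ∈ T, c i j s • u (s : G) (ι (w j))) := by
    simp [hsum, hφ]
  rw [this]
  refine pow_le_pow_left₀ (norm_nonneg _) ((ContinuousLinearMap.le_opNorm _ _).trans ?_) 2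
  refine mul_le_of_le_one_left (norm_nonneg _) ?_
  rw [LinearIsometryEquiv.norm_map]
  exact ι.norm_toContinuousLinearMap_le

theorem isCompletelyContractive_of_dilation (φ : fockAlgebra S →ₗ[ℂ] (H →L[ℂ] H))
    (hcont : Continuous φ) (ι : H →ₗᵢ[ℂ] K) {u : G → K →L[ℂ] K}
    (hu : ∀ a b x, u (a + b) x = u a (u b x)) (hu' : ∀ a x, ‖u a x‖ = ‖x‖)
    (hφ : ∀ s : S, φ (fockGen S s) = ContinuousLinearMap.adjoint ι.toContinuousLinearMap ∘L
      u (s : G) ∘L ι.toContinuousLinearMap) : IsCompletelyContractive φ := by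
  intro n a
  have dense : DenseRange fun (c : Fin n → Fin n → S →₀ ℂ) i j =>
      Finsupp.linearCombination ℂ (fockGen S) (c i j) :=
    DenseRange.piMap fun _ => DenseRange.piMap fun _ => denseRange_linearCombination_fockGen S
  refine isClosed_property (p := fun a : Fin n → Fin n → fockAlgebra S =>
    ‖matrixOperator fun i j => φ (a i j)‖ ≤
      ‖matrixOperator fun i j => (a i j : EllTwo S →L[ℂ] EllTwo S)‖) dense (isClosed_le ?_ ?_)
    (norm_matrixOperator_linearCombination_le φ ι hu hu' hφ) a
  · exact (continuous_matrixOperator.comp (continuous_pi fun i => continuous_pi fun j =>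
      hcont.comp (continuous_apply_apply i j))).norm
  · exact (continuous_matrixOperator.comp (continuous_pi fun i => continuous_pi fun j =>
      continuous_subtype_val.comp (continuous_apply_apply i j))).norm

end Compression

/-! ### Accretive matrices under complete contractions. -/

section CompletePositivity

variable {E : Type*} [NormedAddCommGroup E] [InnerProductSpace ℂ E]
  {H : Type*} [NormedAddCommGroup H] [InnerProductSpace ℂ H] {n : ℕ}

theorem matrixOperator_one_sub_smul (r : ℂ) (M : Matrix (Fin n) (Fin n) (H →L[ℂ] H)) :
    matrixOperator (Matrix.of fun i j => (if i = j then 1 else 0) - r • M i j) =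
      1 - r • matrixOperator M := by
  ext x k
  have : ∀ j, (if k = j then (1 : H →L[ℂ] H) else 0) (x j) = if k = j then x j else 0 :=
    fun j => by split_ifs <;> rfl
  simp [matrixOperator_apply, Finset.smul_sum, Finset.sum_sub_distrib, this]

theorem norm_sub_smul_sq (r : ℝ) (x y : H) :
    ‖x - (r : ℂ) • y‖ ^ 2 = ‖x‖ ^ 2 - 2 * r * (inner ℂ x y).re + r ^ 2 * ‖y‖ ^ 2 := by
  rw [norm_sub_sq (𝕜 := ℂ), inner_smul_right, norm_smul, mul_pow]
  simp
  ring

theorem norm_sq_one_sub_smul_le {T : H →L[ℂ] H} (hT : ∀ x, 0 ≤ (inner ℂ x (T x)).re) {r : ℝ}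
    (hr : 0 ≤ r) : ‖1 - (r : ℂ) • T‖ ^ 2 ≤ 1 + r ^ 2 * ‖T‖ ^ 2 := by
  have hnn : 0 ≤ 1 + r ^ 2 * ‖T‖ ^ 2 := by positivity
  refine (Real.le_sqrt (norm_nonneg _) hnn).1 (ContinuousLinearMap.opNorm_le_bound _
    (Real.sqrt_nonneg _) fun x => ?_)
  rw [← sq_le_sq₀ (norm_nonneg _) (by positivity), mul_pow, Real.sq_sqrt hnn]
  have h1 : ‖(1 - (r : ℂ) • T) x‖ ^ 2 = ‖x - (r : ℂ) • T x‖ ^ 2 := by simp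
  have h2 : ‖T x‖ ^ 2 ≤ (‖T‖ * ‖x‖) ^ 2 := pow_le_pow_left₀ (norm_nonneg _) (T.le_opNorm x) 2
  rw [h1, norm_sub_smul_sq]
  nlinarith [mul_nonneg hr (hT x), mul_le_mul_of_nonneg_left h2 (sq_nonneg r)]

/-- Expanding the square, dividing by `r` and letting `r → 0` isolates the real part. With
`norm_sq_one_sub_smul_le` this expresses accretivity through norms alone. -/
theorem re_inner_nonneg_of_norm_sq_le {T : H →L[ℂ] H} {C : ℝ}
    (h : ∀ r : ℝ, 0 < r → ‖1 - (r : ℂ) • T‖ ^ 2 ≤ 1 + r ^ 2 * C) (x : H) :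
    0 ≤ (inner ℂ x (T x)).re := by
  have key : ∀ r : ℝ, 0 < r → 0 ≤ r * (C * ‖x‖ ^ 2) + 2 * (inner ℂ x (T x)).re := by
    intro r hr
    have h1 : ‖x - (r : ℂ) • T x‖ ^ 2 ≤ (1 + r ^ 2 * C) * ‖x‖ ^ 2 := by
      have : x - (r : ℂ) • T x = (1 - (r : ℂ) • T) x := by simp
      rw [this]
      refine (pow_le_pow_left₀ (norm_nonneg _) (ContinuousLinearMap.le_opNorm _ x) 2).trans ?_
      rw [mul_pow]
      exact mul_le_mul_of_nonneg_right (h r hr) (sq_nonneg _)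
    rw [norm_sub_smul_sq] at h1
    refine le_of_mul_le_mul_left ?_ hr
    nlinarith [mul_nonneg (sq_nonneg r) (sq_nonneg ‖T x‖)]
  have lim : Filter.Tendsto (fun r : ℝ => r * (C * ‖x‖ ^ 2) + 2 * (inner ℂ x (T x)).re)
      (nhdsWithin 0 (Set.Ioi 0)) (nhds (2 * (inner ℂ x (T x)).re)) := by
    have : Continuous fun r : ℝ => r * (C * ‖x‖ ^ 2) + 2 * (inner ℂ x (T x)).re := by fun_prop
    simpa using (this.tendsto 0).mono_left nhdsWithin_le_nhds
  linarith [ge_of_tendsto lim (Filter.eventually_of_mem self_mem_nhdsWithin key)]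

/-- A unital completely contractive map sends accretive matrices to accretive matrices. -/
theorem IsCompletelyContractive.re_inner_nonneg {A : Subalgebra ℂ (E →L[ℂ] E)}
    {φ : A →ₗ[ℂ] (H →L[ℂ] H)} (hφ : IsCompletelyContractive φ) (h1 : φ 1 = 1)
    (a : Matrix (Fin n) (Fin n) A)
    (ha : ∀ w, 0 ≤ (inner ℂ w (matrixOperator (fun i j => (a i j : E →L[ℂ] E)) w)).re)
    (x : PiLp 2 fun _ : Fin n => H) :
    0 ≤ (inner ℂ x (matrixOperator (fun i j => φ (a i j)) x)).re := by
  refine re_inner_nonneg_of_norm_sq_le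
    (C := ‖matrixOperator (fun i j => (a i j : E →L[ℂ] E))‖ ^ 2) (fun r hr => ?_) x
  refine le_trans (pow_le_pow_left₀ (norm_nonneg _) ?_ 2) (norm_sq_one_sub_smul_le ha hr.le)
  have := hφ n (Matrix.of fun i j => (if i = j then 1 else 0) - (r : ℂ) • a i j)
  have h2 := matrixOperator_one_sub_smul (r : ℂ) (Matrix.of fun i j => φ (a i j))
  have h3 := matrixOperator_one_sub_smul (r : ℂ) (Matrix.of fun i j => (a i j : E →L[ℂ] E))
  refine (congrArg norm h2).symm.trans_le (le_trans (le_of_eq ?_)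
    (this.trans (le_of_eq ?_) |>.trans_eq (congrArg norm h3)))
  · congr 2
    ext i j : 2
    simp only [Matrix.of_apply, map_sub, map_smul]
    split_ifs <;> simp [h1]
  · congr 2
    ext i j : 2
    simp only [Matrix.of_apply]
    split_ifs <;> simp

/-- Used twice with the same coefficients: for the `V_s` at arbitrary vectors, and for their images
at an orthonormal basis. -/
theorem inner_matrixOperator_sum {m : ℕ} (X : Fin m → H →L[ℂ] H) (α β : Fin m → Fin n → ℂ)
    (w : Fin n → H) :
    inner ℂ (WithLp.toLp 2 w) (matrixOperator
      (Matrix.of fun j i => ∑ a, (starRingEnd ℂ (β a j) * α a i) • X a) (WithLp.toLp 2 w)) =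
      ∑ a, inner ℂ (∑ j, β a j • w j) (X a (∑ i, α a i • w i)) := by
  simp only [PiLp.inner_apply, matrixOperator_apply, Matrix.of_apply, sum_apply, map_sum, map_smul,
    inner_sum, sum_inner, inner_smul_left, inner_smul_right, smul_apply, Finset.mul_sum]
  rw [Finset.sum_congr rfl fun j _ => Finset.sum_comm, Finset.sum_comm]
  refine Finset.sum_congr rfl fun a _ => ?_
  rw [Finset.sum_comm]
  refine Finset.sum_congr rfl fun i _ => Finset.sum_congr rfl fun j _ => ?_
  ring

theorem re_sum_inner_real_mul_smul {m : ℕ} (X : Fin m → H →L[ℂ] H) (r : Fin m → ℝ)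
    (α β : Fin m → Fin n → ℂ) (w : Fin n → H) :
    (∑ a, inner ℂ (∑ j, β a j • w j) (X a (∑ i, ((r a : ℂ) * α a i) • w i))).re =
      ∑ a, r a * (inner ℂ (∑ j, β a j • w j) (X a (∑ i, α a i • w i))).re := by
  rw [Complex.re_sum]
  refine Finset.sum_congr rfl fun a _ => ?_
  simp only [mul_smul, ← Finset.smul_sum, map_smul, inner_smul_right, Complex.re_ofReal_mul]

end CompletePositivity

/-! ### Real parts of sesquilinear forms. -/

section RealForm

variable {V F : Type*} [AddCommGroup V] [Module ℂ V] [Module ℝ V] [IsScalarTower ℝ ℂ V]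
  [NormedAddCommGroup F] [InnerProductSpace ℂ F]

open TensorProduct

/-- The real functional `x ⊗ y ↦ Re ⟪B y, A x⟫`. -/
noncomputable def reForm (A B : V →ₗ[ℂ] F) : V ⊗[ℝ] V →ₗ[ℝ] ℝ :=
  TensorProduct.lift <| LinearMap.mk₂ ℝ (fun x y => (inner ℂ (B y) (A x)).re)
    (fun x x' y => by simp)
    (fun r x y => by
      rw [← algebraMap_smul ℂ r x, map_smul, inner_smul_right]; simp)
    (fun x y y' => by simp)
    (fun r x y => by
      rw [← algebraMap_smul ℂ r y, map_smul, inner_smul_left]; simp)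

@[simp]
theorem reForm_tmul (A B : V →ₗ[ℂ] F) (x y : V) :
    reForm A B (x ⊗ₜ y) = (inner ℂ (B y) (A x)).re := rfl

end RealForm

/-! ### Translations of `ℓ²(G)`. -/

section Translation

/-- The isometry of `ℓ²` permuting the standard basis by an injective map. -/
noncomputable def basisIsometry {ι κ : Type*} (f : ι → κ) (hf : Function.Injective f) :
    EllTwo ι →ₗᵢ[ℂ] EllTwo κ :=
  ((orthonormal_stdVec κ).comp f hf).orthogonalFamily.linearIsometry

theorem basisIsometry_stdVec {ι κ : Type*} (f : ι → κ) (hf : Function.Injective f) (t : ι) :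
    basisIsometry f hf (stdVec t) = stdVec (f t) := by
  classical
  simp [basisIsometry, stdVec]

variable {G : Type*} [AddCommGroup G]

/-- The translation of `ℓ²(G)` by `g`. -/
noncomputable def translation (g : G) : EllTwo G →ₗᵢ[ℂ] EllTwo G :=
  basisIsometry (g + ·) (add_right_injective g)

theorem translation_stdVec (g t : G) : translation g (stdVec t) = stdVec (g + t) :=
  basisIsometry_stdVec _ _ t

theorem translation_zero (x : EllTwo G) : translation 0 x = x := by
  have : (translation (0 : G)).toContinuousLinearMap = 1 := ext_stdVec fun t => by
    simp [translation_stdVec]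
  exact congr($this x)

theorem translation_add (g h : G) (x : EllTwo G) :
    translation (g + h) x = translation g (translation h x) := by
  have : (translation (g + h)).toContinuousLinearMap =
      (translation g).toContinuousLinearMap ∘L (translation h).toContinuousLinearMap :=
    ext_stdVec fun t => by simp [translation_stdVec, add_assoc]
  exact congr($this x)

variable (S : AddSubmonoid G)

/-- The inclusion of `ℓ²(S)` into `ℓ²(G)`. -/
noncomputable def inclusionEllTwo : EllTwo S →ₗᵢ[ℂ] EllTwo G :=
  basisIsometry Subtype.val Subtype.val_injective

theorem translation_inclusionEllTwo (s : S) (x : EllTwo S) :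
    translation (s : G) (inclusionEllTwo S x) = inclusionEllTwo S (fock S s x) := by
  have : (translation (s : G)).toContinuousLinearMap ∘L (inclusionEllTwo S).toContinuousLinearMap =
      (inclusionEllTwo S).toContinuousLinearMap ∘L fock S s :=
    ext_stdVec fun t => by
      simp [inclusionEllTwo, basisIsometry_stdVec, translation_stdVec, fock_stdVec]
  exact congr($this x)

end Translation

/-! ### Positive extension by M. Riesz's theorem. -/

section Extension

open TensorProduct

variable {G : Type u} [AddCommGroup G] {H : Type v} [NormedAddCommGroup H] [InnerProductSpace ℂ H]

/-- The linear map on finitely supported functions with `h` at `g` sent to `λ_g (W h)`. -/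
noncomputable def induced (W : H →ₗ[ℂ] EllTwo G) : (G →₀ H) →ₗ[ℂ] EllTwo G :=
  Finsupp.lsum ℂ fun g => (translation g).toLinearMap ∘ₗ W

@[simp]
theorem induced_single (W : H →ₗ[ℂ] EllTwo G) (g : G) (h : H) :
    induced W (Finsupp.single g h) = translation g (W h) := by
  simp [induced]

/-- Translation by `g` on finitely supported functions. -/
noncomputable def shift (g : G) : (G →₀ H) ≃ₗ[ℂ] (G →₀ H) :=
  Finsupp.domLCongr (Equiv.addLeft g)

@[simp]
theorem shift_single (g a : G) (h : H) :
    shift g (Finsupp.single a h) = Finsupp.single (g + a) h := by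
  simp [shift]

theorem induced_shift (W : H →ₗ[ℂ] EllTwo G) (g : G) (x : G →₀ H) :
    induced W (shift g x) = translation g (induced W x) := by
  induction x using Finsupp.induction_linear with
  | zero => simp
  | add x y hx hy => simp [hx, hy]
  | single a h => simp [translation_add]

variable (G H) in
/-- The cone dual to the functionals `x ⊗ y ↦ Re ⟪induced W y, induced W x⟫`. -/
noncomputable def dualCone : PointedCone ℝ ((G →₀ H) ⊗[ℝ] (G →₀ H)) where
  carrier := {z | ∀ W : H →ₗ[ℂ] EllTwo G, 0 ≤ reForm (induced W) (induced W) z}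
  zero_mem' := fun W => by simp
  add_mem' := fun hz hz' W => by
    rw [map_add]
    exact add_nonneg (hz W) (hz' W)
  smul_mem' := fun r z hz W => by
    have : r • z = (r : ℝ) • z := rfl
    rw [this, map_smul]
    exact mul_nonneg r.2 (hz W)

variable (S : AddSubmonoid G)

variable (H) in
/-- The real span of the elements `(s, h) ⊗ (0, k)`, `s ∈ S`. -/
noncomputable def analyticSpan : Submodule ℝ ((G →₀ H) ⊗[ℝ] (G →₀ H)) :=
  Submodule.span ℝ (Set.range fun p : S × H × H =>
    Finsupp.single (p.1 : G) p.2.1 ⊗ₜ[ℝ] Finsupp.single (0 : G) p.2.2)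

theorem single_zero_tmul_mem_analyticSpan (h k : H) :
    Finsupp.single (0 : G) h ⊗ₜ[ℝ] Finsupp.single (0 : G) k ∈ analyticSpan H S :=
  Submodule.subset_span ⟨(0, h, k), by simp⟩

/-- This cofinality is what Riesz extension requires. By Cauchy–Schwarz, `‖W h‖² + ‖W k‖²` dominates
the value of every form at `(a, h) ⊗ (b, k)`. -/
theorem exists_add_mem_dualCone (z : (G →₀ H) ⊗[ℝ] (G →₀ H)) :
    ∃ x ∈ analyticSpan H S, x + z ∈ dualCone G H := by
  have add : ∀ z z' : (G →₀ H) ⊗[ℝ] (G →₀ H), (∃ x ∈ analyticSpan H S, x + z ∈ dualCone G H) →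
      (∃ x ∈ analyticSpan H S, x + z' ∈ dualCone G H) →
      ∃ x ∈ analyticSpan H S, x + (z + z') ∈ dualCone G H := by
    rintro z z' ⟨x, hx, hxz⟩ ⟨x', hx', hxz'⟩
    refine ⟨x + x', add_mem hx hx', ?_⟩
    rw [add_add_add_comm]
    exact add_mem hxz hxz'
  have zero : ∃ x ∈ analyticSpan H S, x + 0 ∈ dualCone G H :=
    ⟨0, zero_mem _, by rw [add_zero]; exact zero_mem _⟩
  induction z using TensorProduct.induction_on with
  | zero => exact zero
  | add z z' hz hz' => exact add z z' hz hz'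
  | tmul x y =>
    induction x using Finsupp.induction_linear with
    | zero => rw [zero_tmul]; exact zero
    | add x x' hx hx' => rw [add_tmul]; exact add _ _ hx hx'
    | single a h =>
      induction y using Finsupp.induction_linear with
      | zero => rw [tmul_zero]; exact zero
      | add y y' hy hy' => rw [tmul_add]; exact add _ _ hy hy'
      | single b k =>
        refine ⟨_, add_mem (single_zero_tmul_mem_analyticSpan S h h)
          (single_zero_tmul_mem_analyticSpan S k k), fun W => ?_⟩
        simp only [map_add, reForm_tmul, induced_single, translation_zero]
        have h1 := (Complex.abs_re_le_norm _).trans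
          (norm_inner_le_norm (𝕜 := ℂ) (translation b (W k)) (translation a (W h)))
        rw [LinearIsometry.norm_map, LinearIsometry.norm_map] at h1
        have h2 : ∀ w : EllTwo G, (inner ℂ w w).re = ‖w‖ ^ 2 := fun w =>
          inner_self_eq_norm_sq (𝕜 := ℂ) w
        rw [h2, h2]
        nlinarith [neg_abs_le (inner ℂ (translation b (W k)) (translation a (W h))).re,
          sq_nonneg (‖W h‖ - ‖W k‖), sq_nonneg ‖W h‖, sq_nonneg ‖W k‖]

open Classical in
/-- The linear map sending `h` at `s ∈ S` to `φ (V_s) h`, and `h` at `g ∉ S` to `0`. -/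
noncomputable def fockEval (φ : fockAlgebra S →ₗ[ℂ] (H →L[ℂ] H)) : (G →₀ H) →ₗ[ℂ] H :=
  Finsupp.lsum ℂ fun g => if hg : g ∈ S then (φ (fockGen S ⟨g, hg⟩) : H →ₗ[ℂ] H) else 0

theorem fockEval_single (φ : fockAlgebra S →ₗ[ℂ] (H →L[ℂ] H)) (s : S) (h : H) :
    fockEval S φ (Finsupp.single (s : G) h) = φ (fockGen S s) h := by
  simp [fockEval]

/-- Coordinates in an orthonormal basis of the span of the vectors involved turn `z` into a matrix
over `𝒜(S)`. Membership in the cone makes it accretive; its image under `φ`, evaluated at the basis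
itself, gives the required value. -/
theorem reForm_fockEval_nonneg {φ : fockAlgebra S →ₗ[ℂ] (H →L[ℂ] H)}
    (hφ : IsCompletelyContractive φ) (h1 : φ 1 = 1) {z : (G →₀ H) ⊗[ℝ] (G →₀ H)}
    (hz : z ∈ analyticSpan H S) (hz' : z ∈ dualCone G H) :
    0 ≤ reForm (fockEval S φ) (Finsupp.lapply 0) z := by
  obtain ⟨m, r, p, rfl⟩ := Submodule.mem_span_set'.1 hz
  choose q hq using fun a => (p a).2
  simp only [← hq] at hz' ⊢
  clear hz
  let P : Submodule ℂ H := Submodule.span ℂ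
    (Set.range (fun a => (q a).2.1) ∪ Set.range (fun a => (q a).2.2))
  have : FiniteDimensional ℂ P :=
    FiniteDimensional.span_of_finite ℂ ((Set.finite_range _).union (Set.finite_range _))
  let b := stdOrthonormalBasis ℂ P
  have expand : ∀ x ∈ P, ∑ i, inner ℂ (b i : H) x • (b i : H) = x := fun x hx => by
    simpa using congr(($(b.sum_repr' ⟨x, hx⟩) : H))
  have hh : ∀ a, ∑ i, inner ℂ (b i : H) (q a).2.1 • (b i : H) = (q a).2.1 := fun a =>
    expand _ (Submodule.subset_span (Or.inl ⟨a, rfl⟩))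
  have hk : ∀ a, ∑ i, inner ℂ (b i : H) (q a).2.2 • (b i : H) = (q a).2.2 := fun a =>
    expand _ (Submodule.subset_span (Or.inr ⟨a, rfl⟩))
  let α := fun a i => (r a : ℂ) * inner ℂ (b i : H) (q a).2.1
  let β := fun a i => inner ℂ (b i : H) (q a).2.2
  let M : Matrix (Fin _) (Fin _) (fockAlgebra S) := Matrix.of fun j i =>
    ∑ a, (starRingEnd ℂ (β a j) * α a i) • fockGen S (q a).1
  have hM : ∀ w, 0 ≤ (inner ℂ w (matrixOperator
      (fun i j => (M i j : EllTwo S →L[ℂ] EllTwo S)) w)).re := by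
    intro w
    -- `W` sends `b i` to `w i`, so positivity at `W` is accretivity at `w`.
    let W : H →ₗ[ℂ] EllTwo G :=
      ∑ i, (innerSL ℂ (b i : H)).toLinearMap.smulRight (inclusionEllTwo S (w i))
    have hW : ∀ x, W x = inclusionEllTwo S (∑ i, inner ℂ (b i : H) x • w i) := fun x => by
      simp [W]
    have key := inner_matrixOperator_sum (fun a => fock S (q a).1) α β (fun i => w i)
    have hw := hz' W
    rw [map_sum] at hw
    have hval : (fun i j => (M i j : EllTwo S →L[ℂ] EllTwo S)) =
        Matrix.of fun j i => ∑ a, (starRingEnd ℂ (β a j) * α a i) • fock S (q a).1 := by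
      ext i j : 2
      simp [M, fockGen]
    rw [hval]
    refine le_of_le_of_eq hw (Eq.trans ?_ (congrArg Complex.re key).symm)
    rw [re_sum_inner_real_mul_smul]
    refine Finset.sum_congr rfl fun a _ => ?_
    rw [map_smul, reForm_tmul, induced_single, induced_single, translation_zero, hW, hW,
      translation_inclusionEllTwo, LinearIsometry.inner_map_map, smul_eq_mul]
  have key := inner_matrixOperator_sum (fun a => φ (fockGen S (q a).1)) α β (fun i => (b i : H))
  have hval : (fun i j => φ (M i j)) =
      Matrix.of fun j i => ∑ a, (starRingEnd ℂ (β a j) * α a i) • φ (fockGen S (q a).1) := by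
    ext i j : 2
    simp [M]
  have hb := hφ.re_inner_nonneg h1 M hM (WithLp.toLp 2 fun i => (b i : H))
  rw [hval] at hb
  refine le_of_le_of_eq hb ((congrArg Complex.re key).trans ?_)
  rw [re_sum_inner_real_mul_smul, map_sum]
  refine Finset.sum_congr rfl fun a _ => ?_
  simp only [β]
  rw [map_smul, reForm_tmul, fockEval_single, Finsupp.lapply_apply, Finsupp.single_eq_same, hh, hk,
    smul_eq_mul]

/-- The real part of a positive definite translation invariant form on `H`-valued finitely
supported functions extending a unital completely contractive map. -/
theorem exists_positive_extension {φ : fockAlgebra S →ₗ[ℂ] (H →L[ℂ] H)}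
    (hφ : IsCompletelyContractive φ) (h1 : φ 1 = 1) :
    ∃ f : (G →₀ H) ⊗[ℝ] (G →₀ H) →ₗ[ℝ] ℝ, (∀ z ∈ dualCone G H, 0 ≤ f z) ∧
      ∀ (s : S) (h k : H), f (Finsupp.single (s : G) h ⊗ₜ Finsupp.single 0 k) =
        (inner ℂ k (φ (fockGen S s) h)).re := by
  let f₀ := reForm (fockEval S φ) (Finsupp.lapply 0)
  obtain ⟨f, hf, hpos⟩ := riesz_extension (dualCone G H)
    ⟨analyticSpan H S, f₀ ∘ₗ (analyticSpan H S).subtype⟩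
    (fun x hx => reForm_fockEval_nonneg S hφ h1 x.2 hx)
    (fun y => by
      obtain ⟨x, hx, hxy⟩ := exists_add_mem_dualCone S y
      exact ⟨⟨x, hx⟩, hxy⟩)
  refine ⟨f, hpos, fun s h k => ?_⟩
  have hmem : Finsupp.single (s : G) h ⊗ₜ[ℝ] Finsupp.single (0 : G) k ∈ analyticSpan H S :=
    Submodule.subset_span ⟨(s, h, k), rfl⟩
  refine (hf ⟨_, hmem⟩).trans ?_
  change f₀ (Finsupp.single (s : G) h ⊗ₜ[ℝ] Finsupp.single (0 : G) k) = _
  rw [reForm_tmul, fockEval_single, Finsupp.lapply_apply, Finsupp.single_eq_same]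

/-- Both `z` and `-z` lie in the cone. -/
theorem eq_zero_of_forall_reForm_eq_zero {f : (G →₀ H) ⊗[ℝ] (G →₀ H) →ₗ[ℝ] ℝ}
    (hf : ∀ z ∈ dualCone G H, 0 ≤ f z) {z : (G →₀ H) ⊗[ℝ] (G →₀ H)}
    (hz : ∀ W : H →ₗ[ℂ] EllTwo G, reForm (induced W) (induced W) z = 0) : f z = 0 := by
  refine le_antisymm ?_ (hf z fun W => (hz W).ge)
  have := hf (-z) fun W => by rw [map_neg, hz W, neg_zero]
  rwa [map_neg, Left.nonneg_neg_iff] at this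

end Extension

/-! ### Hilbert spaces from real forms. -/

section Hausdorff

variable {V : Type*} [AddCommGroup V] [Module ℂ V] [Module ℝ V] [IsScalarTower ℝ ℂ V]

/-- The complex positive semidefinite form with real part `β`. -/
noncomputable abbrev preCoreOfRealForm (β : V →ₗ[ℝ] V →ₗ[ℝ] ℝ) (symm : ∀ x y, β x y = β y x)
    (skew : ∀ x y, β x (Complex.I • y) = -β (Complex.I • x) y) (nonneg : ∀ x, 0 ≤ β x x) :
    PreInnerProductSpace.Core ℂ V where
  -- The imaginary part is forced by `Im z = -Re (i z)`.
  inner y x := ⟨β x y, -β (Complex.I • x) y⟩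
  conj_inner_symm y x := by
    apply Complex.ext
    · simp [symm y x]
    · simp only [Complex.conj_im, neg_neg]
      rw [symm, skew]
  re_inner_nonneg x := nonneg x
  add_left x y z := by
    apply Complex.ext
    · simp
    · simp [add_comm]
  smul_left y x r := by
    have hr : r • y = r.re • y + r.im • Complex.I • y := by
      rw [← algebraMap_smul ℂ r.re, ← algebraMap_smul ℂ r.im, smul_smul, ← add_smul]
      simp
    have hI : Complex.I • Complex.I • x = -x := by
      rw [smul_smul, Complex.I_mul_I, neg_one_smul]
    apply Complex.ext
    · simp [hr, skew, sub_eq_add_neg]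
    · simp only [hr, skew, map_add, map_smul, smul_eq_mul, hI, Complex.mul_im, Complex.conj_re,
        Complex.conj_im, map_neg, LinearMap.neg_apply]
      ring

/-- The Hilbert space of a positive semidefinite form. -/
theorem exists_hilbertSpace_of_preCore {V : Type u} [AddCommGroup V] [Module ℂ V]
    (c : PreInnerProductSpace.Core ℂ V) :
    ∃ (K : Type u) (_ : NormedAddCommGroup K) (_ : InnerProductSpace ℂ K) (_ : CompleteSpace K)
      (q : V →ₗ[ℂ] K), DenseRange q ∧ ∀ x y, inner ℂ (q x) (q y) = c.inner x y := by
  let _ : SeminormedAddCommGroup V := InnerProductSpace.Core.toSeminormedAddCommGroup (c := c)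
  let _ : InnerProductSpace ℂ V := InnerProductSpace.ofCore c
  exact ⟨UniformSpace.Completion V, inferInstance, inferInstance, inferInstance,
    (UniformSpace.Completion.toComplL (𝕜 := ℂ) (E := V)).toLinearMap,
    UniformSpace.Completion.denseRange_coe, fun x y => UniformSpace.Completion.inner_coe x y⟩

end Hausdorff

/-! ### The unitary dilation. -/

section Dilation

open TensorProduct

variable {G : Type u} [AddCommGroup G] {H : Type v} [NormedAddCommGroup H] [InnerProductSpace ℂ H]

theorem shift_add (a b : G) (x : G →₀ H) : shift (a + b) x = shift a (shift b x) := by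
  induction x using Finsupp.induction_linear with
  | zero => simp
  | add x y hx hy => simp only [map_add, hx, hy]
  | single a h => simp [add_assoc]

/-- A translation invariant map with dense range induces a unitary representation. -/
theorem exists_unitary_representation {K : Type*} [NormedAddCommGroup K] [InnerProductSpace ℂ K]
    [CompleteSpace K] (q : (G →₀ H) →ₗ[ℂ] K) (hq : DenseRange q)
    (hinv : ∀ g x, ‖q (shift g x)‖ = ‖q x‖) :
    ∃ U : Multiplicative G →* unitary (K →L[ℂ] K),
      ∀ g x, (U (Multiplicative.ofAdd g) : K →L[ℂ] K) (q x) = q (shift g x) := by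
  let T : G → K ≃ₗᵢ[ℂ] K := fun g => (shift g).extendOfIsometry q q hq hq (hinv g)
  have hT : ∀ g x, T g (q x) = q (shift g x) := fun g x =>
    LinearEquiv.extendOfIsometry_eq _ q q hq hq (hinv g) x
  let U : Multiplicative G →* (K ≃ₗᵢ[ℂ] K) := MonoidHom.mk' (fun g => T g.toAdd) fun a b => by
    ext x
    refine congrFun (hq.equalizer (T _).continuous
      ((T _).continuous.comp (T _).continuous) (funext fun x => ?_)) x
    simp only [Function.comp_apply, hT, toAdd_mul, shift_add]
  exact ⟨Unitary.linearIsometryEquiv.symm.toMonoidHom.comp U, hT⟩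

theorem exists_dilation [CompleteSpace H] {S : AddSubmonoid G}
    {φ : fockAlgebra S →ₗ[ℂ] (H →L[ℂ] H)} (hφ : IsCompletelyContractive φ) (h1 : φ 1 = 1) :
    ∃ (K : Type (max u v)) (_ : NormedAddCommGroup K) (_ : InnerProductSpace ℂ K)
      (_ : CompleteSpace K) (ι : H →ₗᵢ[ℂ] K) (U : Multiplicative G →* unitary (K →L[ℂ] K)),
      ∀ s : S, φ (fockGen S s) =
        ContinuousLinearMap.adjoint ι.toContinuousLinearMap ∘L
          (U (Multiplicative.ofAdd (s : G)) : K →L[ℂ] K) ∘L ι.toContinuousLinearMap := by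
  obtain ⟨f, hf, hval⟩ := exists_positive_extension S hφ h1
  let β := TensorProduct.curry f
  have hβ : ∀ x y, β x y = f (x ⊗ₜ y) := fun x y => rfl
  -- Equalities valid for every `W` pass to `β`, although the extension `f` is not explicit.
  have eq_of : ∀ x y x' y' : G →₀ H, (∀ W : H →ₗ[ℂ] EllTwo G,
      (inner ℂ (induced W y) (induced W x)).re = (inner ℂ (induced W y') (induced W x')).re) →
      β x y = β x' y' := by
    intro x y x' y' h
    rw [hβ, hβ, ← sub_eq_zero, ← map_sub]
    refine eq_zero_of_forall_reForm_eq_zero hf fun W => ?_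
    rw [map_sub, reForm_tmul, reForm_tmul, h W, sub_self]
  have symm : ∀ x y, β x y = β y x := fun x y => eq_of _ _ _ _ fun W => inner_re_symm (𝕜 := ℂ) _ _
  have skew : ∀ x y, β x (Complex.I • y) = -β (Complex.I • x) y := by
    intro x y
    rw [← LinearMap.neg_apply, ← map_neg]
    refine eq_of _ _ _ _ fun W => ?_
    rw [map_smul, map_neg, map_smul, inner_neg_right, inner_smul_left, inner_smul_right]
    simp
  have nonneg : ∀ x, 0 ≤ β x x := fun x => hf _ fun W => by
    exact inner_self_nonneg (𝕜 := ℂ)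
  obtain ⟨K, _, _, _, q, hq, hinner⟩ :=
    exists_hilbertSpace_of_preCore (preCoreOfRealForm β symm skew nonneg)
  have hre : ∀ x y, (inner ℂ (q y) (q x)).re = β x y := fun x y => congrArg Complex.re (hinner y x)
  have hnorm : ∀ x, ‖q x‖ ^ 2 = β x x := fun x => by
    rw [← hre]
    exact (inner_self_eq_norm_sq (𝕜 := ℂ) _).symm
  have hinv : ∀ g x, ‖q (shift g x)‖ = ‖q x‖ := fun g x => by
    rw [← sq_eq_sq₀ (norm_nonneg _) (norm_nonneg _), hnorm, hnorm]
    exact eq_of _ _ _ _ fun W => by rw [induced_shift, LinearIsometry.inner_map_map]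
  obtain ⟨U, hU⟩ := exists_unitary_representation q hq hinv
  -- Isometric because `φ 1 = 1`, read at `s = 0`.
  let ι : H →ₗᵢ[ℂ] K :=
    { toLinearMap := q ∘ₗ Finsupp.lsingle 0
      norm_map' := fun h => by
        rw [← sq_eq_sq₀ (norm_nonneg _) (norm_nonneg _)]
        refine (hnorm _).trans ?_
        have := hval 0 h h
        rw [fockGen_zero, h1] at this
        exact this.trans (inner_self_eq_norm_sq (𝕜 := ℂ) h) }
  refine ⟨K, inferInstance, inferInstance, inferInstance, ι, U, fun s => ?_⟩
  have key : ∀ h k : H, (inner ℂ k (φ (fockGen S s) h)).re =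
      (inner ℂ (ι k) ((U (Multiplicative.ofAdd (s : G)) : K →L[ℂ] K) (ι h))).re := by
    intro h k
    rw [← hval, ← hβ, ← hre]
    have : (U (Multiplicative.ofAdd (s : G)) : K →L[ℂ] K) (ι h) = q (Finsupp.single (s : G) h) :=
      (hU _ _).trans (by simp)
    rw [this]
    rfl
  ext h
  refine ext_inner_left ℂ fun k => ?_
  simp only [ContinuousLinearMap.comp_apply, ContinuousLinearMap.adjoint_inner_right,
    LinearIsometry.coe_toContinuousLinearMap]
  -- The imaginary parts follow from the real parts at `i h`.
  apply Complex.ext (key h k)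
  simpa [inner_smul_right] using key (Complex.I • h) k

end Dilation

theorem mainTheorem5 {G : Type u} [AddCommGroup G] (S : AddSubmonoid G) (hS : IsPositiveCone S)
    {H : Type v} [NormedAddCommGroup H] [InnerProductSpace ℂ H] [CompleteSpace H]
    (ρ : fockAlgebra S →A[ℂ] (H →L[ℂ] H)) :
    IsCompletelyContractive (ρ : fockAlgebra S →ₐ[ℂ] (H →L[ℂ] H)).toLinearMap ↔
      ∃ (K : Type (max u v)) (_ : NormedAddCommGroup K) (_ : InnerProductSpace ℂ K)
        (_ : CompleteSpace K) (ι : H →ₗᵢ[ℂ] K) (U : Multiplicative G →* unitary (K →L[ℂ] K)),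
        ∀ s : S, ρ (fockGen S s) =
          ContinuousLinearMap.adjoint ι.toContinuousLinearMap ∘L
            (U (Multiplicative.ofAdd (s : G)) : K →L[ℂ] K) ∘L ι.toContinuousLinearMap := by
  constructor
  · intro h
    exact exists_dilation h (map_one ρ)
  · rintro ⟨K, _, _, _, ι, U, h⟩
    refine isCompletelyContractive_of_dilation _ ρ.cont ι
      (u := fun g => (U (Multiplicative.ofAdd g) : K →L[ℂ] K)) (fun a b x => ?_)
      (fun a x => Unitary.norm_map _ x) h
    simp [ofAdd_add]
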